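/- Fix a universal prefix-free Turing machine $U$ (a partial recursive function on bit strings with prefix-free domain such that for every other such function $V$ there is a string $w$ with $U(wp)=V(p)$ for all $p$) and a finite universal set $B$ of quantum gates (for all sufficiently large $n$ the $n$-qubit circuits over $B$ are dense, up to a global phase, in the unitary group on $n$ qubits). Circuits over $B$ are described by bit strings through a fixed injective computable coding. All logarithms are to base $2$, and pure states are identified when they differ by a global phase. For an $n$-qubit pure state $|\phi\rangle$ let $\mathrm{Knet}(|\phi\rangle)$ be the length of a shortest program $p$ such that $U(p)$ is the description of an $n$-qubit circuit $C$ over $B$ with $|\langle\phi|C|0^n\rangle|^2\ge 1$ (and $\infty$ if there is none). Let $$\mu_n=\sum_{C}D_U(C)\,C|0^n\rangle\langle 0^n|C^\dagger ,\qquad D_U(C)=\sum_{p:\,U(p)=C}2^{-|p|},$$ where $C$ ranges over the $n$-qubit circuits over $B$, be the universal semi-density matrix. Put $\overline H(|\phi\rangle)=-\log\langle\phi|\mu_n|\phi\rangle$ (with $-\log 0=\infty$) and $\overline H^{\varepsilon}(|\psi\rangle)=\sup\{\overline H(|\phi\rangle): D(|\psi\rangle,|\phi\rangle)\le\varepsilon\}$,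 where $D(|\psi\rangle,|\phi\rangle)=\sqrt{1-|\langle\psi|\phi\rangle|^2}$ is the trace distance. For $\gamma>0$, the $\gamma$-robust span of a family $|\psi_1\rangle,\dots,|\psi_L\rangle$ of $n$-qubit states is the subspace spanned by the eigenvectors of $\frac1L\sum_{k=1}^L|\psi_k\rangle\langle\psi_k|$ with eigenvalue at least $\gamma/L$; it is $\{0\}$ if the family is empty. **Theorem.** There is a polynomial $q$, depending only on $U$ and $B$, such that for every $n$, every $n$-qubit pure state $|\psi\rangle$ and all real numbers $r,\Delta,\gamma$ with $\gamma>0$ the following holds. If $\overline H^{0}(|\psi\rangle)\ge r$, and $\Pi_{r,\gamma}$ is the orthogonal projector onto the $\gamma$-robust span of the (finite) family of all $n$-qubit pure states with $\mathrm{Knet}$ at most $r-\Delta$, each taken once, then $$\langle\psi|\Pi_{r,\gamma}|\psi\rangle\;\le\; q(n)\,\gamma^{-1}\,2^{-\Delta}.$$ -/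

import Mathlib

namespace QK

/-! ### Pure states of `n` qubits -/

/-- The state space of `n` qubits, with computational basis indexed by bit strings. -/
abbrev Qubits (n : ℕ) : Type := EuclideanSpace ℂ (Fin n → Bool)

/-- Operators on `n` qubits. -/
abbrev Op (n : ℕ) : Type := Matrix (Fin n → Bool) (Fin n → Bool) ℂ

/-- Unit vectors of the state space of `n` qubits. -/
abbrev PureState (n : ℕ) : Type := {ψ : Qubits n // ‖ψ‖ = 1}

/-- The all-zero basis state. -/
noncomputable def zeroState (n : ℕ) : Qubits n :=
  EuclideanSpace.single (fun _ => false) 1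

/-- The operator `|ψ⟩⟨ψ|`. For unit vectors it determines `ψ` up to a global phase. -/
noncomputable def ketbra {n : ℕ} (ψ : Qubits n) : Op n :=
  Matrix.vecMulVec ψ.ofLp (star ψ.ofLp)

/-- The trace distance of two pure states, `√(1 - |⟨ψ|φ⟩|²)`. -/
noncomputable def traceDist {n : ℕ} (ψ φ : PureState n) : ℝ :=
  Real.sqrt (1 - ‖inner ℂ ψ.1 φ.1‖ ^ 2)

/-! ### Gate sets and circuits -/

/-- A finite set of quantum gates, each acting on some number of qubits. -/
structure GateSet where
  size : ℕ
  arity : Fin size → ℕ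
  gate : (g : Fin size) → Matrix.unitaryGroup (Fin (arity g) → Bool) ℂ

/-- Splits a bit string of length `n` into the bits on the wires `w` and all the others. -/
def splitBits {a n : ℕ} (w : Fin a ↪ Fin n) (x : Fin n → Bool) :
    (Fin a → Bool) × ({i : Fin n // i ∉ Set.range w} → Bool) :=
  (fun j => x (w j), fun i => x i.1)

/-- The operator on `n` qubits that applies `u` to the (ordered) wires `w` and the identity to
the remaining wires. -/
noncomputable def applyOn {a n : ℕ} (w : Fin a ↪ Fin n)
    (u : Matrix (Fin a → Bool) (Fin a → Bool) ℂ) : Op n :=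
  (Matrix.kronecker u
    (1 : Matrix ({i : Fin n // i ∉ Set.range w} → Bool)
      ({i : Fin n // i ∉ Set.range w} → Bool) ℂ)).submatrix (splitBits w) (splitBits w)

/-- A circuit on `n` qubits over the gate set `B`: a finite sequence of gates of `B` (the head is
applied first), each with the distinct wires it acts on. -/
abbrev Circuit (B : GateSet) (n : ℕ) : Type :=
  List ((g : Fin B.size) × (Fin (B.arity g) ↪ Fin n))

/-- The unitary operator of a circuit. -/
noncomputable def Circuit.op {B : GateSet} {n : ℕ} : Circuit B n → Op n
  | [] => 1
  | s :: c => Circuit.op c * applyOn s.2 (B.gate s.1).1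

/-- The state `C|0…0⟩` prepared by a circuit `C`. -/
noncomputable def Circuit.output {B : GateSet} {n : ℕ} (c : Circuit B n) : Qubits n :=
  Matrix.toEuclideanLin c.op (zeroState n)

/-- The classical description of a circuit as a bit string: the number of qubits together with the
list of gates (index of the gate, list of its wires) is coded as a natural number by the standard
(computable, injective) coding, and this number is written in binary. -/
def Circuit.code {B : GateSet} {n : ℕ} (c : Circuit B n) : List Bool :=
  Nat.bits (Encodable.encode
    ((n, c.map fun s => (s.1.1, List.ofFn fun j => (s.2 j).1)) : ℕ × List (ℕ × List ℕ)))

/-- A gate set is universal if, on every sufficiently large number of qubits, its circuits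
approximate every unitary to arbitrary precision, up to a global phase. -/
def GateSet.IsUniversal (B : GateSet) : Prop :=
  ∃ n₀ : ℕ, ∀ n ≥ n₀, ∀ V ∈ Matrix.unitaryGroup (Fin n → Bool) ℂ,
    V ∈ closure {M : Op n | ∃ (c : Circuit B n) (z : ℂ), ‖z‖ = 1 ∧ M = z • c.op}

/-! ### Prefix-free machines -/

/-- No program on which the machine halts is a proper prefix of another one. -/
def PrefixFree (U : List Bool →. List Bool) : Prop :=
  ∀ p q : List Bool, (U p).Dom → (U q).Dom → p <+: q → p = q

/-- A universal prefix-free machine: a partial recursive function on bit strings with prefix-free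
domain that simulates every other such function `V` by prepending a fixed string `w`. -/
structure IsUniversalPrefixFree (U : List Bool →. List Bool) : Prop where
  partrec : Partrec U
  prefixFree : PrefixFree U
  universal : ∀ V : List Bool →. List Bool, Partrec V → PrefixFree V →
    ∃ w : List Bool, ∀ p : List Bool, U (w ++ p) = V p

/-- The universal semi-distribution `D_U(x) = ∑_{p : U(p) = x} 2^{-|p|}`: the probability that a
uniformly random program makes `U` halt with output `x`. -/
noncomputable def semiDist (U : List Bool →. List Bool) (x : List Bool) : ℝ :=
  ∑' p : {p : List Bool // x ∈ U p}, (1 / 2 : ℝ) ^ p.1.length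

/-! ### Complexity of states -/

/-- `Knet^ε(ψ)`: the length of a shortest program on which `U` outputs the description of a circuit
`C` on `n` qubits with `|⟨ψ|C|0…0⟩|² ≥ 1 - ε`, and `⊤` if there is none. -/
noncomputable def Knet (U : List Bool →. List Bool) (B : GateSet) {n : ℕ} (ε : ℝ)
    (ψ : PureState n) : ℕ∞ :=
  sInf {l : ℕ∞ | ∃ (p : List Bool) (c : Circuit B n), c.code ∈ U p ∧
    1 - ε ≤ ‖inner ℂ ψ.1 c.output‖ ^ 2 ∧ l = (p.length : ℕ∞)}

/-- The universal semi-density matrix on `n` qubits: the mixture of the states `C|0…0⟩`, where the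
`n`-qubit circuit `C` has the weight with which the universal semi-distribution outputs its
description. -/
noncomputable def universalMatrix (U : List Bool →. List Bool) (B : GateSet) (n : ℕ) : Op n :=
  ∑' c : Circuit B n, semiDist U c.code • ketbra c.output

/-- `⟨ψ|M|ψ⟩` (as a real number). -/
noncomputable def expect {n : ℕ} (M : Op n) (ψ : PureState n) : ℝ :=
  (inner ℂ ψ.1 (Matrix.toEuclideanLin M ψ.1)).re

open Classical in
/-- `H̄(ψ) = - log₂ ⟨ψ|μ|ψ⟩` for the universal semi-density matrix `μ`, with `- log₂ 0 = ⊤`. -/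
noncomputable def Hbar (U : List Bool →. List Bool) (B : GateSet) {n : ℕ}
    (ψ : PureState n) : EReal :=
  if expect (universalMatrix U B n) ψ = 0 then ⊤
  else ((-Real.logb 2 (expect (universalMatrix U B n) ψ) : ℝ) : EReal)

/-- `H̄^ε(ψ)`: the largest value of `H̄` at trace distance at most `ε` from `ψ`. -/
noncomputable def HbarSmooth (U : List Bool →. List Bool) (B : GateSet) {n : ℕ} (ε : ℝ)
    (ψ : PureState n) : EReal :=
  ⨆ φ ∈ {φ : PureState n | traceDist ψ φ ≤ ε}, Hbar U B φ

/-! ### Robust spans -/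

/-- The uniform mixture `(1/L) ∑ₖ |ψₖ⟩⟨ψₖ|` of a family of states given as operators `|ψₖ⟩⟨ψₖ|`. -/
noncomputable def uniformMixture {n : ℕ} {ι : Type*} [Fintype ι] (P : ι → Op n) : Op n :=
  (Fintype.card ι : ℝ)⁻¹ • ∑ k, P k

/-- The `γ`-robust span of a family of `L` states: the span of the eigenvectors of the uniform
mixture with eigenvalue at least `γ / L`. The robust span of the empty family is zero. -/
noncomputable def robustSpan {n : ℕ} {ι : Type*} [Fintype ι] (P : ι → Op n) (γ : ℝ) :
    Submodule ℂ (Qubits n) :=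
  Submodule.span ℂ {v | ∃ a : ℝ, 0 < Fintype.card ι ∧ γ / (Fintype.card ι : ℝ) ≤ a ∧
    Matrix.toEuclideanLin (uniformMixture P) v = (a : ℂ) • v}

/-- The `n`-qubit pure states with `Knet` at most `s`, where `Knet = Knet^0`. States that differ by
a global phase are the same state; a state is represented by `|ψ⟩⟨ψ|`. -/
def easyStates (U : List Bool →. List Bool) (B : GateSet) (n : ℕ) (s : ℝ) : Set (Op n) :=
  {P | ∃ ψ : PureState n, (∃ k : ℕ, Knet U B 0 ψ = (k : ℕ∞) ∧ (k : ℝ) ≤ s) ∧ P = ketbra ψ.1}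

/-- The squared length `⟨ψ|Π|ψ⟩` of the orthogonal projection of `ψ` to the subspace `W`. -/
noncomputable def overlap {n : ℕ} (W : Submodule ℂ (Qubits n)) (ψ : PureState n) : ℝ :=
  (inner ℂ ψ.1 (W.starProjection ψ.1)).re

/-! ### There are finitely many easy states -/

theorem splitBits_bijective {a n : ℕ} (w : Fin a ↪ Fin n) :
    Function.Bijective (splitBits w) := by
  classical
  constructor
  · intro x y h
    funext i
    by_cases hi : i ∈ Set.range w
    · obtain ⟨j, rfl⟩ := hi
      exact congrFun (congrArg Prod.fst h) j
    · exact congrFun (congrArg Prod.snd h) ⟨i, hi⟩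
  · rintro ⟨u, v⟩
    refine ⟨fun i => if hi : i ∈ Set.range w then u hi.choose else v ⟨i, hi⟩, ?_⟩
    refine Prod.ext ?_ ?_
    · funext j
      have hj : w j ∈ Set.range w := ⟨j, rfl⟩
      have : hj.choose = j := w.injective hj.choose_spec
      simp only [splitBits]
      rw [dif_pos hj, this]
    · funext i
      simp only [splitBits]
      rw [dif_neg i.2]

theorem applyOn_mem_unitary {a n : ℕ} (w : Fin a ↪ Fin n)
    (u : Matrix.unitaryGroup (Fin a → Bool) ℂ) :
    applyOn w u.1 ∈ Matrix.unitaryGroup (Fin n → Bool) ℂ := by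
  classical
  set K := Matrix.kronecker u.1
    (1 : Matrix ({i : Fin n // i ∉ Set.range w} → Bool)
      ({i : Fin n // i ∉ Set.range w} → Bool) ℂ) with hK
  have h1 : K ∈ unitary (Matrix ((Fin a → Bool) × ({i : Fin n // i ∉ Set.range w} → Bool))
      ((Fin a → Bool) × ({i : Fin n // i ∉ Set.range w} → Bool)) ℂ) :=
    Matrix.kronecker_mem_unitary u.2 (one_mem _)
  have h2 := Unitary.mul_star_self_of_mem h1
  rw [Matrix.mem_unitaryGroup_iff]
  let e := Equiv.ofBijective _ (splitBits_bijective w)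
  have h3 : applyOn w u.1 = K.submatrix e e := rfl
  rw [h3, Matrix.star_eq_conjTranspose, Matrix.conjTranspose_submatrix,
    Matrix.submatrix_mul_equiv, ← Matrix.star_eq_conjTranspose, h2]
  exact Matrix.submatrix_one_equiv e

theorem op_mem_unitary {B : GateSet} {n : ℕ} (c : Circuit B n) :
    c.op ∈ Matrix.unitaryGroup (Fin n → Bool) ℂ := by
  induction c with
  | nil => exact one_mem _
  | cons s c ih => exact mul_mem ih (applyOn_mem_unitary _ _)

theorem norm_output {B : GateSet} {n : ℕ} (c : Circuit B n) : ‖c.output‖ = 1 := by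
  have h := op_mem_unitary c
  have h1 : ‖c.output‖ = ‖zeroState n‖ := by
    have hA : (Matrix.toEuclideanLin c.op).adjoint ∘ₗ Matrix.toEuclideanLin c.op
        = LinearMap.id := by
      rw [← Matrix.toEuclideanLin_conjTranspose_eq_adjoint, ← Matrix.toLpLin_mul_same,
        ← Matrix.star_eq_conjTranspose, Unitary.star_mul_self_of_mem h]
      exact Matrix.toLpLin_one 2
    have h2 : inner ℂ c.output c.output = inner ℂ (zeroState n) (zeroState n) := by
      unfold Circuit.output
      rw [← LinearMap.adjoint_inner_left, ← LinearMap.comp_apply, hA]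
      rfl
    rw [norm_eq_sqrt_re_inner (𝕜 := ℂ), norm_eq_sqrt_re_inner (𝕜 := ℂ), h2]
  rw [h1]
  simp [zeroState]

theorem bits_injective : Function.Injective Nat.bits := by
  intro a b h
  have h2 : Nat.digits 2 a = Nat.digits 2 b := by
    rw [Nat.digits_two_eq_bits, Nat.digits_two_eq_bits, h]
  exact Nat.digits_inj_iff.mp h2

theorem code_injective {B : GateSet} {n : ℕ} :
    Function.Injective (Circuit.code : Circuit B n → List Bool) := by
  intro c d h
  have h1 := Encodable.encode_injective (bits_injective h)
  have h2 := congrArg Prod.snd h1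
  refine List.map_injective_iff.mpr ?_ h2
  rintro ⟨g, w⟩ ⟨g', w'⟩ hs
  simp only [Prod.mk.injEq] at hs
  obtain ⟨hg, hw⟩ := hs
  obtain rfl := Fin.ext hg
  have h3 := List.ofFn_injective hw
  congr 1
  ext j
  exact congrFun h3 j

theorem ketbra_eq {n : ℕ} {ψ φ : Qubits n} (hψ : ‖ψ‖ = 1) (hφ : ‖φ‖ = 1)
    (h : 1 ≤ ‖inner ℂ ψ φ‖ ^ 2) : ketbra ψ = ketbra φ := by
  have h1 : ‖inner ℂ ψ φ‖ = ‖ψ‖ * ‖φ‖ := by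
    refine le_antisymm (norm_inner_le_norm ψ φ) ?_
    rw [hψ, hφ, one_mul]
    nlinarith [norm_nonneg (inner ℂ ψ φ)]
  have h0 : ψ ≠ 0 := by
    rintro rfl
    simp at hψ
  have h3 : ψ = 0 ∨ ∃ z : ℂ, φ = z • ψ :=
    ((norm_inner_eq_norm_tfae ℂ ψ φ).out 0 2).mp h1
  obtain ⟨z, hz⟩ := h3.resolve_left h0
  have hz1 : z * star z = 1 := by
    have : ‖z‖ = 1 := by
      rw [hz, norm_smul, hψ, mul_one] at hφ
      exact hφ
    rw [← starRingEnd_apply, Complex.mul_conj, Complex.normSq_eq_norm_sq, this]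
    simp
  subst hz
  ext i j
  simp only [ketbra, Matrix.vecMulVec_apply, Pi.star_apply, PiLp.smul_apply, smul_eq_mul,
    star_mul']
  linear_combination (-(ψ.ofLp i * star (ψ.ofLp j))) * hz1

theorem easyStates_finite (U : List Bool →. List Bool) (B : GateSet) (n : ℕ) (s : ℝ) :
    (easyStates U B n s).Finite := by
  have hfin : {p : List Bool | p.length ≤ ⌊s⌋₊}.Finite := List.finite_length_le Bool _
  refine (hfin.biUnion (t := fun p =>
    {P : Op n | ∃ c : Circuit B n, c.code ∈ U p ∧ P = ketbra c.output}) ?_).subset ?_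
  · intro p _
    refine Set.Subsingleton.finite ?_
    rintro _ ⟨c, hc, rfl⟩ _ ⟨d, hd, rfl⟩
    rw [code_injective (Part.mem_unique hc hd)]
  · rintro _ ⟨ψ, ⟨k, hk, hks⟩, rfl⟩
    have hne : {l : ℕ∞ | ∃ (p : List Bool) (c : Circuit B n), c.code ∈ U p ∧
        1 - (0 : ℝ) ≤ ‖inner ℂ ψ.1 c.output‖ ^ 2 ∧ l = (p.length : ℕ∞)}.Nonempty := by
      by_contra hcon
      rw [Set.not_nonempty_iff_eq_empty] at hcon
      rw [Knet, hcon, sInf_empty] at hk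
      exact ENat.natCast_ne_top k hk.symm
    obtain ⟨p, c, hc, hov, hl⟩ := csInf_mem hne
    have hpk : p.length = k := by
      have : ((p.length : ℕ) : ℕ∞) = (k : ℕ∞) := hl.symm.trans hk
      exact_mod_cast this
    refine Set.mem_biUnion (x := p) ?_ ⟨c, hc, ?_⟩
    · simp only [Set.mem_ofPred_eq, hpk]
      exact Nat.le_floor hks
    · rw [sub_zero] at hov
      exact ketbra_eq ψ.2 (norm_output c) hov

noncomputable instance easyStatesFintype (U : List Bool →. List Bool) (B : GateSet) (n : ℕ) (s : ℝ) :
    Fintype (easyStates U B n s) :=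
  (easyStates_finite U B n s).fintype

end QK

namespace QK

/-! ### Prefix-free sets of programs -/

/-! A state with `Knet` at most `s = r - Δ` is, up to phase, the output of a circuit that has a
program of length at most `s`, so this circuit has weight at least `2^(-s)` in the universal mixture
`μ`. Distinct states come from distinct circuits, hence `∑ₖ |ψₖ⟩⟨ψₖ| ≤ 2^s μ` in expectation
(`sum_expect_easyStates_le`). On the robust span the uniform mixture is at least `γ / L`; the factor
`1 / L` cancels, so `γ Π ≤ ∑ₖ |ψₖ⟩⟨ψₖ|` however many easy states there are
(`mul_overlap_robustSpan_le`). At `ε = 0` the entropy hypothesis says `⟨ψ|μ|ψ⟩ ≤ 2^(-r)`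
(`expect_universalMatrix_le`). Together, `γ ⟨ψ|Π|ψ⟩ ≤ 2^(r - Δ) 2^(-r) = 2^(-Δ)`. Kraft's inequality
enters only to make the series for `semiDist` and `μ` converge. -/

theorem uniquelyDecodable_of_prefixFree {α : Type*} {S : Set (List α)} (h0 : [] ∉ S)
    (h : ∀ p ∈ S, ∀ q ∈ S, p <+: q → p = q) : InformationTheory.UniquelyDecodable S := by
  intro L₁
  induction L₁ with
  | nil =>
    rintro (_ | ⟨w, L⟩) - h2 he
    · rfl
    · have hw : w = [] := by
        simp only [List.flatten_nil, List.flatten_cons] at he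
        exact (List.append_eq_nil_iff.mp he.symm).1
      exact absurd (hw ▸ h2 w (by simp)) h0
  | cons v L₁ ih =>
    rintro (_ | ⟨w, L⟩) h1 h2 he
    · have hv : v = [] := by
        simp only [List.flatten_nil, List.flatten_cons] at he
        exact (List.append_eq_nil_iff.mp he).1
      exact absurd (hv ▸ h1 v (by simp)) h0
    · simp only [List.flatten_cons] at he
      have hv : v ∈ S := h1 v (by simp)
      have hw : w ∈ S := h2 w (by simp)
      have hvw : v = w := by
        rcases List.prefix_or_prefix_of_prefix (List.prefix_append v L₁.flatten)
          (he ▸ List.prefix_append w L.flatten) with hp | hp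
        · exact h v hv w hw hp
        · exact (h w hw v hv hp).symm
      subst hvw
      rw [ih L (fun x hx => h1 x (by simp [hx])) (fun x hx => h2 x (by simp [hx]))
        (List.append_cancel_left he)]

/-- Kraft's inequality gives the summability of the weights of the halting programs. -/
theorem PrefixFree.summable {U : List Bool →. List Bool} (hU : PrefixFree U) :
    Summable fun p : {p : List Bool // (U p).Dom} => (1 / 2 : ℝ) ^ p.1.length := by
  classical
  -- The empty word is never part of a uniquely decodable code, so this case is separate: halting on
  -- it leaves no other program in a prefix-free domain.
  by_cases h0 : (U []).Dom
  · have : Subsingleton {p : List Bool // (U p).Dom} :=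
      ⟨fun p q => Subtype.ext
        ((hU [] p.1 h0 p.2 List.nil_prefix).symm.trans (hU [] q.1 h0 q.2 List.nil_prefix))⟩
    exact Summable.of_finite
  · refine summable_of_sum_le (c := 1) (fun p => by positivity) fun u => ?_
    have hud : InformationTheory.UniquelyDecodable
        ((u.image Subtype.val : Finset (List Bool)) : Set (List Bool)) := by
      refine uniquelyDecodable_of_prefixFree ?_ ?_
      · simp [h0]
      · intro p hp q hq hpq
        simp only [Finset.coe_image, Set.mem_image, Finset.mem_coe] at hp hq
        obtain ⟨p', -, rfl⟩ := hp
        obtain ⟨q', -, rfl⟩ := hq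
        exact hU _ _ p'.2 q'.2 hpq
    have := InformationTheory.kraft_mcmillan_inequality hud
    rw [Finset.sum_image Subtype.val_injective.injOn] at this
    simpa using this

/-- A program has at most one output, so pairs of an output and a program for it inject into the
halting programs. This yields convergence of each `semiDist U x` and of their sum over `x`. -/
theorem PrefixFree.summable_sigma {U : List Bool →. List Bool} (hU : PrefixFree U) :
    Summable fun y : (x : List Bool) × {p : List Bool // x ∈ U p} =>
      (1 / 2 : ℝ) ^ y.2.1.length := by
  let i : ((x : List Bool) × {p : List Bool // x ∈ U p}) → {p : List Bool // (U p).Dom} :=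
    fun y => ⟨y.2.1, Part.dom_iff_mem.mpr ⟨y.1, y.2.2⟩⟩
  have hi : Function.Injective i := by
    rintro ⟨x, p, hp⟩ ⟨y, q, hq⟩ h
    obtain rfl : p = q := Subtype.ext_iff.mp h
    obtain rfl := Part.mem_unique hp hq
    rfl
  have hs := hU.summable.comp_injective hi
  exact hs

theorem summable_programs {U : List Bool →. List Bool} (hU : PrefixFree U) (x : List Bool) :
    Summable fun p : {p : List Bool // x ∈ U p} => (1 / 2 : ℝ) ^ p.1.length :=
  hU.summable_sigma.sigma_factor x

theorem semiDist_nonneg (U : List Bool →. List Bool) (x : List Bool) : 0 ≤ semiDist U x :=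
  tsum_nonneg fun _ => by positivity

theorem pow_length_le_semiDist {U : List Bool →. List Bool} (hU : PrefixFree U)
    {x p : List Bool} (hp : x ∈ U p) : (1 / 2 : ℝ) ^ p.length ≤ semiDist U x :=
  (summable_programs hU x).le_tsum ⟨p, hp⟩ fun _ _ => by positivity

theorem summable_semiDist {U : List Bool →. List Bool} (hU : PrefixFree U) :
    Summable (semiDist U) :=
  hU.summable_sigma.sigma

/-! ### Expectations -/

/-- The expectation in the state `ψ` as a linear functional. -/
noncomputable def expectLin {n : ℕ} (ψ : PureState n) : Op n →ₗ[ℝ] ℝ where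
  toFun M := expect M ψ
  map_add' M N := by simp [expect]
  map_smul' a M := by
    have h : Matrix.toEuclideanLin (a • M) ψ.1 = (a : ℂ) • Matrix.toEuclideanLin M ψ.1 := by
      rw [← LinearMap.smul_apply, ← map_smul]
      congr 2
    rw [expect, h, inner_smul_right, Complex.re_ofReal_mul]
    rfl

theorem expect_ketbra {n : ℕ} (φ : Qubits n) (ψ : PureState n) :
    expect (ketbra φ) ψ = ‖inner ℂ ψ.1 φ‖ ^ 2 := by
  have h : Matrix.toEuclideanLin (ketbra φ) ψ.1 = inner ℂ φ ψ.1 • φ := by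
    ext i
    simp only [ketbra, Matrix.toLpLin_apply, Matrix.vecMulVec_mulVec, PiLp.smul_apply,
      PiLp.inner_apply, RCLike.inner_apply, dotProduct, Pi.smul_apply, Pi.star_apply,
      MulOpposite.smul_eq_mul_unop, MulOpposite.unop_op, smul_eq_mul]
    rw [mul_comm]
    congr 1
    exact Finset.sum_congr rfl fun j _ => mul_comm _ _
  rw [expect, h, inner_smul_right, ← inner_conj_symm, ← Complex.normSq_eq_conj_mul_self,
    Complex.ofReal_re, Complex.normSq_eq_norm_sq]

theorem expect_ketbra_nonneg {n : ℕ} (φ : Qubits n) (ψ : PureState n) :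
    0 ≤ expect (ketbra φ) ψ := by
  rw [expect_ketbra]
  positivity

theorem norm_ketbra_apply_le {n : ℕ} {φ : Qubits n} (hφ : ‖φ‖ = 1) (i j : Fin n → Bool) :
    ‖ketbra φ i j‖ ≤ 1 := by
  have h (k) : ‖φ.ofLp k‖ ≤ 1 := hφ ▸ PiLp.norm_apply_le φ k
  simp only [ketbra, Matrix.vecMulVec_apply, Pi.star_apply, norm_mul, norm_star]
  exact mul_le_one₀ (h i) (norm_nonneg _) (h j)

/-- Entries of `ketbra` of a unit vector have modulus at most 1, so the series is dominated
entrywise by the weights. Without summability the `tsum` defining the matrix would default to zero.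
-/
theorem summable_universalMatrix {U : List Bool →. List Bool} (hU : PrefixFree U)
    (B : GateSet) (n : ℕ) :
    Summable fun c : Circuit B n => semiDist U c.code • ketbra c.output := by
  have hs : Summable fun c : Circuit B n => semiDist U c.code :=
    (summable_semiDist hU).comp_injective code_injective
  refine Pi.summable.mpr fun i => Pi.summable.mpr fun j => ?_
  refine Summable.of_norm_bounded hs fun c => ?_
  rw [Matrix.smul_apply, norm_smul, Real.norm_of_nonneg (semiDist_nonneg U _)]
  exact mul_le_of_le_one_right (semiDist_nonneg U _) (norm_ketbra_apply_le (norm_output c) i j)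

theorem hasSum_expect_universalMatrix {U : List Bool →. List Bool} (hU : PrefixFree U)
    (B : GateSet) {n : ℕ} (ψ : PureState n) :
    HasSum (fun c : Circuit B n => semiDist U c.code * expect (ketbra c.output) ψ)
      (expect (universalMatrix U B n) ψ) := by
  have hc : Continuous (expectLin ψ) := LinearMap.continuous_of_finiteDimensional _
  have h := (summable_universalMatrix hU B n).hasSum.map (expectLin ψ) hc
  have he : (fun c : Circuit B n => semiDist U c.code * expect (ketbra c.output) ψ) =
      expectLin ψ ∘ fun c : Circuit B n => semiDist U c.code • ketbra c.output := by
    funext c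
    simp only [Function.comp_apply, map_smul, smul_eq_mul]
    rfl
  rw [he]
  exact h

/-! ### Smooth entropy at zero trace distance -/

/-- Equality in Cauchy–Schwarz makes the two states differ by a phase, which cancels in the
expectation. Thus smoothing with `ε = 0` changes nothing. -/
theorem expect_eq_of_traceDist_le_zero {n : ℕ} {ψ φ : PureState n} (h : traceDist ψ φ ≤ 0)
    (M : Op n) : expect M φ = expect M ψ := by
  have h1 : 1 ≤ ‖inner ℂ ψ.1 φ.1‖ ^ 2 := by
    have := Real.sqrt_eq_zero'.mp (le_antisymm h (Real.sqrt_nonneg _))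
    linarith
  have h2 : ‖inner ℂ ψ.1 φ.1‖ = ‖ψ.1‖ * ‖φ.1‖ := by
    refine le_antisymm (norm_inner_le_norm _ _) ?_
    rw [ψ.2, φ.2, one_mul]
    nlinarith [norm_nonneg (inner ℂ ψ.1 φ.1)]
  have h0 : ψ.1 ≠ 0 := by
    intro h
    have := ψ.2
    simp [h] at this
  have h3 : ψ.1 = 0 ∨ ∃ z : ℂ, φ.1 = z • ψ.1 :=
    ((norm_inner_eq_norm_tfae ℂ ψ.1 φ.1).out 0 2).mp h2
  obtain ⟨z, hz⟩ := h3.resolve_left h0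
  have hz1 : ‖z‖ = 1 := by
    have := φ.2
    rwa [hz, norm_smul, ψ.2, mul_one] at this
  have hz2 : z * (starRingEnd ℂ) z = 1 := by
    rw [Complex.mul_conj, Complex.normSq_eq_norm_sq, hz1]
    simp
  rw [expect, hz, map_smul, inner_smul_right, inner_smul_left, ← mul_assoc, hz2, one_mul, expect]

theorem expect_universalMatrix_le {U : List Bool →. List Bool} (hU : PrefixFree U)
    (B : GateSet) {n : ℕ} (ψ : PureState n) {r : ℝ} (h : (r : EReal) ≤ HbarSmooth U B 0 ψ) :
    expect (universalMatrix U B n) ψ ≤ (2 : ℝ) ^ (-r) := by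
  have h1 : HbarSmooth U B 0 ψ ≤ Hbar U B ψ := by
    refine iSup₂_le fun φ hφ => le_of_eq ?_
    rw [Hbar, Hbar, expect_eq_of_traceDist_le_zero hφ]
  have h2 := h.trans h1
  have h0 : 0 ≤ expect (universalMatrix U B n) ψ :=
    (hasSum_expect_universalMatrix hU B ψ).nonneg fun c =>
      mul_nonneg (semiDist_nonneg U _) (expect_ketbra_nonneg _ _)
  rw [Hbar] at h2
  split_ifs at h2 with hz
  · rw [hz]
    positivity
  · rw [EReal.coe_le_coe_iff] at h2
    rw [← Real.logb_le_iff_le_rpow one_lt_two (lt_of_le_of_ne h0 (Ne.symm hz))]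
    linarith

/-! ### Easy states -/

theorem exists_circuit_of_mem_easyStates {U : List Bool →. List Bool} (hU : PrefixFree U)
    {B : GateSet} {n : ℕ} {s : ℝ} {P : Op n} (hP : P ∈ easyStates U B n s) :
    ∃ c : Circuit B n, P = ketbra c.output ∧ (2 : ℝ) ^ (-s) ≤ semiDist U c.code := by
  obtain ⟨ψ, ⟨k, hk, hks⟩, rfl⟩ := hP
  have hne : {l : ℕ∞ | ∃ (p : List Bool) (c : Circuit B n), c.code ∈ U p ∧
      1 - (0 : ℝ) ≤ ‖inner ℂ ψ.1 c.output‖ ^ 2 ∧ l = (p.length : ℕ∞)}.Nonempty := by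
    by_contra hcon
    rw [Set.not_nonempty_iff_eq_empty] at hcon
    rw [Knet, hcon, sInf_empty] at hk
    exact ENat.natCast_ne_top k hk.symm
  -- The order on `ℕ∞` is a well-order, so the infimum is attained by an actual shortest program.
  obtain ⟨p, c, hc, hov, hl⟩ := csInf_mem hne
  have hpk : p.length = k := by
    have : ((p.length : ℕ) : ℕ∞) = (k : ℕ∞) := hl.symm.trans hk
    exact_mod_cast this
  rw [sub_zero] at hov
  refine ⟨c, ketbra_eq ψ.2 (norm_output c) hov, le_trans ?_ (pow_length_le_semiDist hU hc)⟩
  rw [hpk, one_div, inv_pow, ← Real.rpow_natCast, ← Real.rpow_neg zero_le_two]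
  exact Real.rpow_le_rpow_of_exponent_le one_le_two (neg_le_neg hks)

theorem sum_expect_easyStates_le {U : List Bool →. List Bool} (hU : PrefixFree U)
    (B : GateSet) {n : ℕ} (ψ : PureState n) (s : ℝ) :
    ∑ P : easyStates U B n s, expect (P : Op n) ψ ≤
      (2 : ℝ) ^ s * expect (universalMatrix U B n) ψ := by
  choose c hc hw using fun P : easyStates U B n s => exists_circuit_of_mem_easyStates hU P.2
  -- The circuit determines its output state, so no term of the series for `μ` is used twice.
  have hinj : Function.Injective c := fun P Q h => Subtype.ext (by rw [hc P, hc Q, h])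
  have hterm (d : Circuit B n) : 0 ≤ semiDist U d.code * expect (ketbra d.output) ψ :=
    mul_nonneg (semiDist_nonneg U _) (expect_ketbra_nonneg _ _)
  have h1 : ∑ P : easyStates U B n s, (2 : ℝ) ^ (-s) * expect (P : Op n) ψ ≤
      expect (universalMatrix U B n) ψ := by
    refine le_trans (Finset.sum_le_sum fun P _ => ?_) (le_trans (le_of_eq (Finset.sum_map
      Finset.univ ⟨c, hinj⟩ fun d => semiDist U d.code * expect (ketbra d.output) ψ).symm)
      (sum_le_hasSum _ (fun d _ => hterm d) (hasSum_expect_universalMatrix hU B ψ)))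
    rw [Function.Embedding.coeFn_mk, ← hc P]
    exact mul_le_mul_of_nonneg_right (hw P) (hc P ▸ expect_ketbra_nonneg _ _)
  rw [← Finset.mul_sum] at h1
  have h2 := mul_le_mul_of_nonneg_left h1 (Real.rpow_nonneg zero_le_two s)
  rwa [← mul_assoc, ← Real.rpow_add two_pos, add_neg_cancel, Real.rpow_zero, one_mul] at h2

/-! ### Robust spans -/

/-- The span of the eigenvectors of a positive operator `T` with eigenvalue at least `t` has
`t` times its projection bounded by `T`. -/
theorem mul_re_inner_starProjection_span_le {E : Type*} [NormedAddCommGroup E]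
    [InnerProductSpace ℂ E] [FiniteDimensional ℂ E] {T : E →ₗ[ℂ] E} (hT : T.IsPositive) {t : ℝ}
    (ht : 0 ≤ t) (W : Submodule ℂ E)
    (hW : W = Submodule.span ℂ {v | ∃ a : ℝ, t ≤ a ∧ T v = (a : ℂ) • v}) (x : E) :
    t * (inner ℂ x (W.starProjection x)).re ≤ (inner ℂ x (T x)).re := by
  classical
  set b := hT.isSymmetric.eigenvectorBasis rfl
  set ev := hT.isSymmetric.eigenvalues rfl
  have hTb (i) : T (b i) = (ev i : ℂ) • b i := hT.isSymmetric.apply_eigenvectorBasis rfl i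
  have hinner (i) (v : E) : inner ℂ (b i) (T v) = (ev i : ℂ) * inner ℂ (b i) v := by
    rw [← hT.isSymmetric, hTb, inner_smul_left, Complex.conj_ofReal]
  have hev0 (i) : 0 ≤ ev i := by
    have h := hT.re_inner_nonneg_right (b i)
    rw [hinner, inner_self_eq_norm_sq_to_K, b.norm_eq_one] at h
    simpa using h
  -- Eigenvectors of a symmetric operator for different eigenvalues are orthogonal. This is the only
  -- property of the span that is needed; no basis of `W` is extracted.
  have hperp (w : E) (hw : w ∈ W) (i) (hi : ev i < t) : inner ℂ (b i) w = 0 := by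
    rw [hW] at hw
    induction hw using Submodule.span_induction with
    | mem v hv =>
      obtain ⟨a, ha, hav⟩ := hv
      have h := hinner i v
      rw [hav, inner_smul_right, ← sub_eq_zero, ← sub_mul, mul_eq_zero] at h
      refine h.resolve_left fun h' => ?_
      rw [sub_eq_zero, Complex.ofReal_inj] at h'
      linarith
    | zero => exact inner_zero_right _
    | add u v _ _ hu hv => rw [inner_add_right, hu, hv, add_zero]
    | smul a v _ hv => rw [inner_smul_right, hv, mul_zero]
  set w := W.starProjection x
  have hwW : w ∈ W := W.starProjection_apply_mem x
  have hnorm : (inner ℂ x w).re = ‖w‖ ^ 2 := by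
    have h := W.re_inner_starProjection_eq_normSq x
    rw [inner_re_symm] at h
    exact h
  have hexp (v : E) : (inner ℂ x v).re = ∑ i, (inner ℂ x (b i) * inner ℂ (b i) v).re := by
    rw [← b.sum_inner_mul_inner, Complex.re_sum]
  have hTx : (inner ℂ x (T x)).re = ∑ i, ev i * ‖inner ℂ (b i) x‖ ^ 2 := by
    rw [hexp]
    refine Finset.sum_congr rfl fun i _ => ?_
    rw [hinner, mul_left_comm, ← inner_conj_symm, ← Complex.normSq_eq_conj_mul_self,
      Complex.normSq_eq_norm_sq, ← Complex.ofReal_mul, Complex.ofReal_re]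
  -- Coordinatewise AM-GM, with `t ≤ ev i` wherever `w` has a nonzero coordinate. As `⟨x, w⟩` has
  -- real part `‖w‖²`, summation gives `2t‖w‖² ≤ t‖w‖² + ⟨x, T x⟩`.
  have key : ∑ i, t * (2 * (inner ℂ x (b i) * inner ℂ (b i) w).re) ≤
      ∑ i, (t * ‖inner ℂ (b i) w‖ ^ 2 + ev i * ‖inner ℂ (b i) x‖ ^ 2) := by
    refine Finset.sum_le_sum fun i _ => ?_
    by_cases hi : ev i < t
    · rw [hperp w hwW i hi]
      simpa using mul_nonneg (hev0 i) (sq_nonneg _)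
    · have h1 : (inner ℂ x (b i) * inner ℂ (b i) w).re ≤
          ‖inner ℂ (b i) x‖ * ‖inner ℂ (b i) w‖ := by
        rw [norm_inner_symm (b i) x, ← norm_mul]
        exact Complex.re_le_norm _
      have h2 := two_mul_le_add_sq ‖inner ℂ (b i) x‖ ‖inner ℂ (b i) w‖
      calc t * (2 * (inner ℂ x (b i) * inner ℂ (b i) w).re)
          ≤ t * (‖inner ℂ (b i) x‖ ^ 2 + ‖inner ℂ (b i) w‖ ^ 2) :=
            mul_le_mul_of_nonneg_left (by linarith) ht
        _ = t * ‖inner ℂ (b i) w‖ ^ 2 + t * ‖inner ℂ (b i) x‖ ^ 2 := by ring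
        _ ≤ _ := add_le_add_right
            (mul_le_mul_of_nonneg_right (not_lt.mp hi) (sq_nonneg _)) _
  rw [Finset.sum_add_distrib, ← hTx, ← Finset.mul_sum, ← Finset.mul_sum, ← Finset.mul_sum,
    ← hexp, b.sum_sq_norm_inner_right, hnorm] at key
  rw [hnorm]
  linarith

open scoped ComplexOrder in
theorem mul_overlap_robustSpan_le {n : ℕ} {ι : Type*} [Fintype ι] (P : ι → Op n)
    (hP : ∀ i, (P i).PosSemidef) {γ : ℝ} (hγ : 0 < γ) (ψ : PureState n) :
    γ * overlap (robustSpan P γ) ψ ≤ ∑ i, expect (P i) ψ := by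
  -- The factor `1 / L` can be cancelled only for a nonempty family; for an empty one the robust
  -- span is zero by definition.
  rcases Nat.eq_zero_or_pos (Fintype.card ι) with h0 | hpos
  · have hW : robustSpan P γ = ⊥ := by
      rw [robustSpan, Submodule.span_eq_bot]
      rintro v ⟨a, ha, -⟩
      omega
    have := Fintype.card_eq_zero_iff.mp h0
    simp [overlap, hW]
  have hL : (0 : ℝ) < Fintype.card ι := by exact_mod_cast hpos
  have hmix : (uniformMixture P).PosSemidef :=
    (Matrix.posSemidef_sum _ fun i _ => hP i).smul (inv_nonneg.mpr hL.le)
  have h := mul_re_inner_starProjection_span_le (Matrix.isPositive_toEuclideanLin_iff.mpr hmix)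
    (div_nonneg hγ.le hL.le) (robustSpan P γ) (by simp only [robustSpan, hpos, true_and]) ψ.1
  have he : (inner ℂ ψ.1 (Matrix.toEuclideanLin (uniformMixture P) ψ.1)).re =
      (Fintype.card ι : ℝ)⁻¹ * ∑ i, expect (P i) ψ := by
    change expectLin ψ (uniformMixture P) = _
    rw [uniformMixture, map_smul, map_sum]
    rfl
  rw [he, div_eq_inv_mul, mul_assoc] at h
  exact le_of_mul_le_mul_left h (inv_pos.mpr hL)

open scoped ComplexOrder in
theorem posSemidef_of_mem_easyStates {U : List Bool →. List Bool} {B : GateSet} {n : ℕ} {s : ℝ}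
    {P : Op n} (hP : P ∈ easyStates U B n s) : P.PosSemidef := by
  obtain ⟨ψ, -, rfl⟩ := hP
  exact Matrix.posSemidef_vecMulVec_self_star _

end QK

theorem mainTheorem11 (U : List Bool →. List Bool) (hU : QK.IsUniversalPrefixFree U)
    (B : QK.GateSet) (hB : B.IsUniversal) :
    ∃ q : Polynomial ℕ, ∀ (n : ℕ) (ψ : QK.PureState n) (r Δ γ : ℝ), 0 < γ →
      (r : EReal) ≤ QK.HbarSmooth U B 0 ψ →
      QK.overlap
          (QK.robustSpan (fun P : QK.easyStates U B n (r - Δ) => (P : QK.Op n)) γ) ψ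
        ≤ ((q.eval n : ℕ) : ℝ) * γ⁻¹ * (2 : ℝ) ^ (-Δ) := by
  -- No polynomial loss occurs: the constant 1 suffices, because easy states and `μ` are defined
  -- through the same circuits and machine.
  refine ⟨1, fun n ψ r Δ γ hγ hr => ?_⟩
  have h1 := QK.mul_overlap_robustSpan_le
    (fun P : QK.easyStates U B n (r - Δ) => (P : QK.Op n))
    (fun P => QK.posSemidef_of_mem_easyStates P.2) hγ ψ
  have h2 := QK.sum_expect_easyStates_le hU.prefixFree B ψ (r - Δ)
  have h3 := mul_le_mul_of_nonneg_left (QK.expect_universalMatrix_le hU.prefixFree B ψ hr)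
    (Real.rpow_nonneg zero_le_two (r - Δ))
  rw [← Real.rpow_add two_pos, show r - Δ + -r = -Δ by ring] at h3
  rw [Polynomial.eval_one, Nat.cast_one, one_mul, inv_mul_eq_div, le_div_iff₀' hγ]
  exact h1.trans (h2.trans h3)
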